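/- Let $n\ge 0$ and let $s=(s_1,\dots,s_n)$ be a sequence of positive integers. Let $$P_n^s=\Bigl\{x\in\mathbb R^n : 0\le \tfrac{x_1}{s_1}\le \tfrac{x_2}{s_2}\le\cdots\le\tfrac{x_n}{s_n}\le 1\Bigr\}$$ be the $s$-lecture hall simplex, with vertices $v^{(0)},\dots,v^{(n)}\in\mathbb Z^n$, and let $$\Pi^\circ=\Bigl\{\textstyle\sum_{i=0}^n\lambda_i\,(v^{(i)},1)\in\mathbb R^{n+1} : 0<\lambda_i<1 \text{ for } 0\le i\le n\Bigr\}$$ be its open parallelepiped. The $s$-derangement polynomial is the box polynomial (local $h^\ast$-polynomial) of $P_n^s$, $$d_n^s(z)=\sum_{(x_1,\dots,x_{n+1})\in\Pi^\circ\cap\mathbb Z^{n+1}}z^{x_{n+1}}.$$ Then $d_n^s(z)$ is $\gamma$-nonnegative with respect to degree $n+1$: there are real numbers $\gamma_0,\dots,\gamma_{\lfloor (n+1)/2\rfloor}\ge 0$ with $$d_n^s(z)=\sum_{i=0}^{\lfloor (n+1)/2\rfloor}\gamma_i\,z^i(z+1)^{n+1-2i}.$$ Moreover $d_n^s(z)$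 is symmetric with respect to degree $n+1$ (it has degree at most $n+1$, and the coefficients of $z^k$ and $z^{n+1-k}$ agree for $0\le k\le n+1$), and it is real-rooted (it is identically zero or all of its complex zeros are real). -/

import Mathlib

open Polynomial

noncomputable section

namespace LectureHall

/-- The `s`-lecture hall simplex `0 ≤ x₁/s₁ ≤ x₂/s₂ ≤ ⋯ ≤ xₙ/sₙ ≤ 1` in `ℝⁿ`. -/
def lectureHallSimplex {n : ℕ} (s : Fin n → ℕ) : Set (Fin n → ℝ) :=
  {x | (∀ i, 0 ≤ x i / s i) ∧ Monotone (fun i => x i / s i) ∧ ∀ i, x i / s i ≤ 1}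

/-- The point `(v, 1)` of `ℝⁿ⁺¹`; the last coordinate is the height. -/
def atHeightOne {n : ℕ} (v : Fin n → ℝ) : Fin (n + 1) → ℝ :=
  Fin.snoc (α := fun _ => ℝ) v 1

/-- The open parallelepiped of a simplex `P ⊆ ℝⁿ`: all `∑ c_v (v, 1)` with `0 < c_v < 1`,
the sum being over the vertices (extreme points) `v` of `P`. -/
def openParallelepiped {n : ℕ} (P : Set (Fin n → ℝ)) : Set (Fin (n + 1) → ℝ) :=
  {y | ∃ c : (Fin n → ℝ) → ℝ,
    (∀ v ∈ P.extremePoints ℝ, 0 < c v ∧ c v < 1) ∧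
    y = ∑ᶠ v ∈ P.extremePoints ℝ, c v • atHeightOne v}

/-- The points of `ℤⁿ⁺¹` in the open parallelepiped. -/
def boxPoints {n : ℕ} (P : Set (Fin n → ℝ)) : Set (Fin (n + 1) → ℤ) :=
  {x | (fun i => (x i : ℝ)) ∈ openParallelepiped P}

/-- The box polynomial (local `h*`-polynomial) of a lattice simplex `P`: the generating
polynomial of the heights of the lattice points in the open parallelepiped. This point set is
finite, and heights are positive, being sums of positive coefficients. -/
def boxPolynomial {n : ℕ} (P : Set (Fin n → ℝ)) : ℝ[X] :=
  ∑ᶠ x ∈ boxPoints P, (X : ℝ[X]) ^ (x (Fin.last n)).toNat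

/-- The `s`-derangement polynomial. -/
def sDerangementPolynomial {n : ℕ} (s : Fin n → ℕ) : ℝ[X] :=
  boxPolynomial (lectureHallSimplex s)

/-- `p` has degree at most `d`, and `p_k = p_{d-k}` for `0 ≤ k ≤ d`. -/
def IsSymmetric (d : ℕ) (p : ℝ[X]) : Prop :=
  p.natDegree ≤ d ∧ ∀ k ≤ d, p.coeff k = p.coeff (d - k)

/-- `p` is zero or all its complex zeros are real. -/
def IsRealRooted (p : ℝ[X]) : Prop :=
  p = 0 ∨ ∀ z : ℂ, aeval z p = 0 → z.im = 0

/-- `p` is `γ`-nonnegative with respect to degree `d`: it is a combination of the polynomials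
`zⁱ (z + 1)^(d - 2i)`, `0 ≤ i ≤ ⌊d/2⌋`, with nonnegative coefficients. (These polynomials are
linearly independent, so the coefficients are unique.) -/
def IsGammaNonnegative (d : ℕ) (p : ℝ[X]) : Prop :=
  ∃ γ : ℕ → ℝ, (∀ i ≤ d / 2, 0 ≤ γ i) ∧
    p = ∑ i ∈ Finset.range (d / 2 + 1), C (γ i) * (X ^ i * (X + 1) ^ (d - 2 * i))

end LectureHall

end

/- Real-rootedness is proved by following the arguments of the polynomials in the recursion at a
fixed point of the upper half plane; symmetry and real-rootedness then give `γ`-nonnegativity. -/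

/-! A point of the open parallelepiped has coefficients `λ_j` equal to the successive differences of
`0, x₁/s₁, …, xₙ/sₙ, xₙ₊₁`. So the lattice points at height `h` are the chains, ending at `h`, whose
differences all lie strictly between `0` and `1` (`mem_chains`). Let the end be `ρ + m` with `0 ≤ ρ
< 1`, and let `t` be the fractional part of `xₙ/sₙ`: its floor is `m` if `t < ρ` and `m - 1` if `t >
ρ`, while `t = ρ` is impossible. This is the recursion `descentStep` (`coeff_chainPolynomial`), and
the derangement polynomial is the case `ρ = 0`.

Real-rootedness: at a fixed `z` in the upper half plane, the arguments of the values grow as `ρ`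
decreases, by at most `arg z` in total. The recursion preserves this (`IsArgOrdered.descentStep`).
Its summands then lie in a cone of angle `arg z < π` and cannot cancel, so a nonzero polynomial of
the family has no zero in the upper half plane, nor by conjugation in the lower one.

Symmetry comes from `λ ↦ 1 - λ`. Since the coefficients are nonnegative, the nonzero roots are
negative and pair off as `x, x⁻¹`; each pair contributes the factor `(X + 1)² + (-x - x⁻¹ - 2) X`,
which has nonnegative `γ`-coefficients (`isGammaNonnegative_of_realRooted`). -/

open Polynomial

noncomputable section

namespace LectureHall

/-! ### Comparing arguments of complex numbers -/

/-- The signed area spanned by two complex numbers; its sign compares their arguments. -/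
def cross (u v : ℂ) : ℝ := u.re * v.im - u.im * v.re

lemma cross_add_left (u v w : ℂ) : cross (u + v) w = cross u w + cross v w := by
  simp only [cross, Complex.add_re, Complex.add_im]; ring

lemma cross_add_right (u v w : ℂ) : cross u (v + w) = cross u v + cross u w := by
  simp only [cross, Complex.add_re, Complex.add_im]; ring

lemma cross_swap (u v : ℂ) : cross u v = -cross v u := by
  simp only [cross]; ring

lemma cross_self (u : ℂ) : cross u u = 0 := by
  simp only [cross]; ring

@[simp] lemma cross_zero_left (v : ℂ) : cross 0 v = 0 := by simp [cross]

@[simp] lemma cross_zero_right (v : ℂ) : cross v 0 = 0 := by simp [cross]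

lemma cross_mul_mul (z u v : ℂ) : cross (z * u) (z * v) = Complex.normSq z * cross u v := by
  simp only [cross, Complex.mul_re, Complex.mul_im, Complex.normSq_apply]; ring

lemma cross_mul_self (z u : ℂ) : cross u (z * u) = z.im * Complex.normSq u := by
  simp only [cross, Complex.mul_re, Complex.mul_im, Complex.normSq_apply]; ring

lemma cross_sum_left {ι : Type*} (T : Finset ι) (f : ι → ℂ) (w : ℂ) :
    cross (∑ t ∈ T, f t) w = ∑ t ∈ T, cross (f t) w := by
  classical
  induction T using Finset.induction_on with
  | empty => simp
  | insert a T ha ih => rw [Finset.sum_insert ha, Finset.sum_insert ha, cross_add_left, ih]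

lemma cross_sum_right {ι : Type*} (T : Finset ι) (f : ι → ℂ) (w : ℂ) :
    cross w (∑ t ∈ T, f t) = ∑ t ∈ T, cross w (f t) := by
  rw [cross_swap, cross_sum_left, ← Finset.sum_neg_distrib]
  exact Finset.sum_congr rfl fun t _ => (cross_swap _ _).symm

/-- For decreasing parameter, the arguments of the values of `f` increase, and altogether by at
most the argument of `z`. -/
def IsArgOrdered (z : ℂ) (f : ℝ → ℂ) : Prop :=
  ∀ ρ σ, ρ ≤ σ → 0 ≤ cross (f σ) (f ρ) ∧ 0 ≤ cross (f ρ) (z * f σ)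

lemma IsArgOrdered.cross_sum_nonneg {z : ℂ} {f : ℝ → ℂ} (hf : IsArgOrdered z f) {T U : Finset ℝ}
    (h : ∀ t ∈ T, ∀ u ∈ U, t ≤ u) : 0 ≤ cross (∑ u ∈ U, f u) (∑ t ∈ T, f t) := by
  rw [cross_sum_left]
  refine Finset.sum_nonneg fun u hu => ?_
  rw [cross_sum_right]
  exact Finset.sum_nonneg fun t ht => (hf t u (h t ht u hu)).1

lemma IsArgOrdered.cross_mul_sum_nonneg {z : ℂ} {f : ℝ → ℂ} (hf : IsArgOrdered z f)
    {T U : Finset ℝ} (h : ∀ t ∈ T, ∀ u ∈ U, t ≤ u) :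
    0 ≤ cross (∑ t ∈ T, f t) (z * ∑ u ∈ U, f u) := by
  rw [cross_sum_left]
  refine Finset.sum_nonneg fun t ht => ?_
  rw [Finset.mul_sum, cross_sum_right]
  exact Finset.sum_nonneg fun u hu => (hf t u (h t ht u hu)).2

/-! ### The descent recursion at a point of the upper half plane -/

/-- One step of the descent recursion: the parameters `t ∈ S` below `ρ` are counted with weight
`1`, those above `ρ` with weight `z`. -/
def descentStep {R : Type*} [CommSemiring R] (z : R) (S : Finset ℝ) (f : ℝ → R) (ρ : ℝ) : R :=
  ∑ t ∈ S with t < ρ, f t + z * ∑ t ∈ S with ρ < t, f t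

lemma map_descentStep {R R' : Type*} [CommSemiring R] [CommSemiring R'] (φ : R →+* R') (z : R)
    (S : Finset ℝ) (f : ℝ → R) (ρ : ℝ) :
    φ (descentStep z S f ρ) = descentStep (φ z) S (fun t => φ (f t)) ρ := by
  simp [descentStep]

lemma sum_filter_lt_split {M : Type*} [AddCommMonoid M] (S : Finset ℝ) (f : ℝ → M) {ρ σ : ℝ}
    (h : ρ < σ) :
    ∑ t ∈ S with t < σ, f t =
      ∑ t ∈ S with t < ρ, f t + ∑ t ∈ S with t = ρ, f t + ∑ t ∈ S with ρ < t ∧ t < σ, f t := by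
  simp only [Finset.sum_filter, ← Finset.sum_add_distrib]
  refine Finset.sum_congr rfl fun t _ => ?_
  rcases lt_trichotomy t ρ with h1 | h1 | h1
  · simp [h1, h1.trans h, h1.ne, h1.not_gt]
  · simp [h1, h]
  · simp [h1, h1.ne', h1.not_gt]

lemma sum_filter_gt_split {M : Type*} [AddCommMonoid M] (S : Finset ℝ) (f : ℝ → M) {ρ σ : ℝ}
    (h : ρ < σ) :
    ∑ t ∈ S with ρ < t, f t =
      ∑ t ∈ S with ρ < t ∧ t < σ, f t + ∑ t ∈ S with t = σ, f t + ∑ t ∈ S with σ < t, f t := by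
  simp only [Finset.sum_filter, ← Finset.sum_add_distrib]
  refine Finset.sum_congr rfl fun t _ => ?_
  rcases lt_trichotomy t σ with h1 | h1 | h1
  · simp [h1, h1.ne, h1.not_gt]
  · simp [h1, h]
  · simp [h1, h.trans h1, h1.ne', h1.not_gt]

/-- Both cross products expand bilinearly over blocks of parameters. Terms without a sign of their
own cancel or combine into some `cross w (z * w)`; the hypothesis on `f` makes the others
nonnegative. -/
lemma IsArgOrdered.descentStep {z : ℂ} (hz : 0 < z.im) {f : ℝ → ℂ} (hf : IsArgOrdered z f)
    (S : Finset ℝ) : IsArgOrdered z (descentStep z S f) := by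
  intro ρ σ hρσ
  rcases hρσ.eq_or_lt with rfl | hlt
  · rw [cross_self, cross_mul_self]
    exact ⟨le_rfl, mul_nonneg hz.le (Complex.normSq_nonneg _)⟩
  have key : ∀ p q : ℝ → Prop, (∀ t u, p t → q u → t ≤ u) →
      ∀ [DecidablePred p] [DecidablePred q],
      0 ≤ cross (∑ u ∈ S with q u, f u) (∑ t ∈ S with p t, f t) ∧
      0 ≤ cross (∑ t ∈ S with p t, f t) (z * ∑ u ∈ S with q u, f u) := by
    intro p q h _ _
    have h' : ∀ t ∈ S.filter p, ∀ u ∈ S.filter q, t ≤ u := fun t ht u hu =>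
      h t u (Finset.mem_filter.1 ht).2 (Finset.mem_filter.1 hu).2
    exact ⟨hf.cross_sum_nonneg h', hf.cross_mul_sum_nonneg h'⟩
  have hAa := key (· < ρ) (· = ρ) (by intros; linarith)
  have hAM := key (· < ρ) (fun t => ρ < t ∧ t < σ) (by rintro t u h ⟨h1, h2⟩; linarith)
  have hAb := key (· < ρ) (· = σ) (by intros; linarith)
  have hAB := key (· < ρ) (σ < ·) (by intros; linarith)
  have haM := key (· = ρ) (fun t => ρ < t ∧ t < σ) (by rintro t u h ⟨h1, h2⟩; linarith)
  have hab := key (· = ρ) (· = σ) (by intros; linarith)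
  have haB := key (· = ρ) (σ < ·) (by intros; linarith)
  have hMb := key (fun t => ρ < t ∧ t < σ) (· = σ) (by rintro t u ⟨h1, h2⟩ h; linarith)
  have hMB := key (fun t => ρ < t ∧ t < σ) (σ < ·) (by rintro t u ⟨h1, h2⟩ h; linarith)
  have hbB := key (· = σ) (σ < ·) (by intros; linarith)
  unfold LectureHall.descentStep
  -- With blocks `A, a, M, b, B` (below `ρ`, at `ρ`, between, at `σ`, above `σ`), the step has value
  -- `A + z (M + b + B)` at `ρ` and `A + a + M + z B` at `σ`.
  rw [sum_filter_lt_split S f hlt, sum_filter_gt_split S f hlt]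
  generalize (∑ t ∈ S with t < ρ, f t) = A at *
  generalize (∑ t ∈ S with t = ρ, f t) = a at *
  generalize (∑ t ∈ S with ρ < t ∧ t < σ, f t) = M at *
  generalize (∑ t ∈ S with t = σ, f t) = b at *
  generalize (∑ t ∈ S with σ < t, f t) = B at *
  have hN := Complex.normSq_nonneg z
  have self : ∀ w : ℂ, 0 ≤ cross w (z * w) := fun w => by
    rw [cross_mul_self]; exact mul_nonneg hz.le (Complex.normSq_nonneg _)
  have scale : ∀ u v : ℂ, 0 ≤ cross u v → 0 ≤ cross (z * u) (z * v) := fun u v h => by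
    rw [cross_mul_mul]; exact mul_nonneg hN h
  constructor
  · have e : cross (A + a + M + z * B) (A + z * (M + b + B)) =
        cross A (z * M) + cross A (z * b) + cross a A + cross a (z * M) + cross a (z * b)
        + cross a (z * B) + cross M A + cross M (z * M) + cross M (z * b) + cross M (z * B)
        + cross (z * B) (z * M) + cross (z * B) (z * b) := by
      simp only [mul_add, cross_add_left, cross_add_right, cross_self]
      rw [cross_swap (z * B) A]; ring
    rw [e]
    have h1 := self M
    have h2 := scale _ _ hMB.1
    have h3 := scale _ _ hbB.1
    linarith [hAM.2, hAb.2, hAa.1, haM.2, hab.2, haB.2, hAM.1, hMb.2, hMB.2]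
  -- `cross A (z * (z * B))` may be negative, as `z² B` can be turned too far from `A`; it is
  -- absorbed into the first term on the right.
  · have e : cross (A + z * (M + b + B)) (z * (A + a + M + z * B)) =
        cross (A + z * B) (z * (A + z * B)) + cross A (z * a) + cross A (z * M)
        + cross (z * M) (z * A) + cross (z * M) (z * a) + cross (z * M) (z * (z * B))
        + cross (z * b) (z * A) + cross (z * b) (z * a) + cross (z * b) (z * M)
        + cross (z * b) (z * (z * B)) + cross (z * B) (z * a) + cross (z * B) (z * M) := by
      simp only [mul_add, cross_add_left, cross_add_right, cross_self]
      ring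
    rw [e]
    have h1 := self (A + z * B)
    have h2 := scale _ _ hAM.1
    have h3 := scale _ _ haM.1
    have h4 := scale _ _ hMB.2
    have h5 := scale _ _ hAb.1
    have h6 := scale _ _ hab.1
    have h7 := scale _ _ hMb.1
    have h8 := scale _ _ hbB.2
    have h9 := scale _ _ haB.1
    have h10 := scale _ _ hMB.1
    linarith [hAa.2, hAM.2]

/-- Sums of numbers in the cone spanned by `u` and `z u` do not cancel. -/
lemma IsArgOrdered.descentStep_ne_zero {z : ℂ} (hz : 0 < z.im) {f : ℝ → ℂ}
    (hf : IsArgOrdered z f) (S : Finset ℝ) {ρ t₀ : ℝ} (ht₀ : t₀ ∈ S) (hne : t₀ ≠ ρ)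
    (h0 : f t₀ ≠ 0) : LectureHall.descentStep z S f ρ ≠ 0 := by
  -- The linear functional `w ↦ cross u w + cross w (z * u)` is nonnegative on the cone spanned by
  -- `u` and `z u`. It suffices that every summand has a nonnegative value and one a positive value.
  suffices h : ∃ u : ℂ, (∀ t ∈ S, t < ρ → 0 ≤ cross u (f t) + cross (f t) (z * u)) ∧
      (∀ t ∈ S, ρ < t → 0 ≤ cross u (z * f t) + cross (z * f t) (z * u)) ∧
      ((∃ t ∈ S, t < ρ ∧ 0 < cross u (f t) + cross (f t) (z * u)) ∨
        ∃ t ∈ S, ρ < t ∧ 0 < cross u (z * f t) + cross (z * f t) (z * u)) by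
    obtain ⟨u, h1, h2, h3⟩ := h
    intro hzero
    have e : cross u (LectureHall.descentStep z S f ρ) +
        cross (LectureHall.descentStep z S f ρ) (z * u) =
        ∑ t ∈ S with t < ρ, (cross u (f t) + cross (f t) (z * u)) +
        ∑ t ∈ S with ρ < t, (cross u (z * f t) + cross (z * f t) (z * u)) := by
      simp only [LectureHall.descentStep, Finset.mul_sum, cross_add_left, cross_add_right,
        cross_sum_left, cross_sum_right, Finset.sum_add_distrib]
      ring
    rw [hzero, cross_zero_left, cross_zero_right, add_zero] at e
    have h1' : ∀ t ∈ S.filter (· < ρ), 0 ≤ cross u (f t) + cross (f t) (z * u) := fun t ht =>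
      h1 t (Finset.mem_filter.1 ht).1 (Finset.mem_filter.1 ht).2
    have h2' : ∀ t ∈ S.filter (ρ < ·), 0 ≤ cross u (z * f t) + cross (z * f t) (z * u) :=
      fun t ht => h2 t (Finset.mem_filter.1 ht).1 (Finset.mem_filter.1 ht).2
    have n1 := Finset.sum_nonneg h1'
    have n2 := Finset.sum_nonneg h2'
    rcases h3 with ⟨t, ht, hlt, hpos⟩ | ⟨t, ht, hlt, hpos⟩
    · have := Finset.sum_pos' h1' ⟨t, Finset.mem_filter.2 ⟨ht, hlt⟩, hpos⟩
      linarith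
    · have := Finset.sum_pos' h2' ⟨t, Finset.mem_filter.2 ⟨ht, hlt⟩, hpos⟩
      linarith
  have self_pos : ∀ w : ℂ, w ≠ 0 → 0 < cross w (z * w) := fun w hw => by
    rw [cross_mul_self]; exact mul_pos hz (Complex.normSq_pos.2 hw)
  -- The summand of least argument serves as `u`, up to the factor `z`: the nonzero value at the
  -- least parameter above `ρ`, or, if there is none, at the greatest below `ρ`.
  by_cases hB : ∃ t ∈ S, ρ < t ∧ f t ≠ 0
  · obtain ⟨t₁, ht₁, hρ₁, hf₁⟩ := hB
    obtain ⟨m, hm, hmin⟩ := Finset.exists_min_image (S.filter fun t => ρ < t ∧ f t ≠ 0) id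
      ⟨t₁, Finset.mem_filter.2 ⟨ht₁, hρ₁, hf₁⟩⟩
    simp only [Finset.mem_filter, id] at hm hmin
    refine ⟨f m, fun t _ htρ => ?_, fun t ht htρ => ?_, Or.inr ⟨m, hm.1, hm.2.1, ?_⟩⟩
    · have := hf t m (by linarith)
      exact add_nonneg this.1 this.2
    · by_cases h : f t = 0
      · simp [h]
      · have := hf m t (hmin t ⟨ht, htρ, h⟩)
        rw [cross_mul_mul]
        exact add_nonneg this.2 (mul_nonneg (Complex.normSq_nonneg _) this.1)
    · rw [cross_self, add_zero]
      exact self_pos _ hm.2.2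
  · push Not at hB
    have hlt : t₀ < ρ := lt_of_le_of_ne (not_lt.1 fun h => h0 (hB t₀ ht₀ h)) hne
    obtain ⟨m, hm, hmax⟩ := Finset.exists_max_image (S.filter fun t => t < ρ ∧ f t ≠ 0) id
      ⟨t₀, Finset.mem_filter.2 ⟨ht₀, hlt, h0⟩⟩
    simp only [Finset.mem_filter, id] at hm hmax
    refine ⟨f m, fun t ht htρ => ?_, fun t ht htρ => ?_, Or.inl ⟨m, hm.1, hm.2.1, ?_⟩⟩
    · by_cases h : f t = 0
      · simp [h]
      · have := hf t m (hmax t ⟨ht, htρ, h⟩)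
        exact add_nonneg this.1 this.2
    · simp [hB t ht htρ]
    · rw [cross_self, zero_add]
      exact self_pos _ hm.2.2

/-! ### Chain polynomials and their real-rootedness -/

/-- The fractions `0, 1/k, …, (k-1)/k`. -/
def fractions (k : ℕ) : Finset ℝ := (Finset.range k).image fun e : ℕ => (e : ℝ) / k

/-- The generating polynomial of the floors of the last entry of lecture hall chains whose next
entry has fractional part `ρ`. -/
def chainPolynomial : (n : ℕ) → (Fin n → ℕ) → ℝ → ℝ[X]
  -- The empty chain only requires `0 < ρ + m < 1`: impossible for `ρ = 0`, and `m = 0` for `0 < ρ <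
  -- 1`.
  | 0, _ => fun ρ => if ρ = 0 then 0 else 1
  | n + 1, s => descentStep X (fractions (s (Fin.last n))) (chainPolynomial n (Fin.init s))

lemma isArgOrdered_chainPolynomial {z : ℂ} (hz : 0 < z.im) (n : ℕ) (s : Fin n → ℕ) :
    IsArgOrdered z fun ρ => aeval z (chainPolynomial n s ρ) := by
  induction n with
  | zero =>
    intro ρ σ _
    by_cases h1 : ρ = 0 <;> by_cases h2 : σ = 0 <;> simp [chainPolynomial, h1, h2, cross, hz.le]
  | succ n ih =>
    have h := (ih (Fin.init s)).descentStep hz (fractions (s (Fin.last n)))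
    convert h using 2 with ρ
    have := map_descentStep (aeval z : ℝ[X] →ₐ[ℝ] ℂ).toRingHom X (fractions (s (Fin.last n)))
      (chainPolynomial n (Fin.init s)) ρ
    simpa [chainPolynomial] using this

lemma chainPolynomial_aeval_ne_zero {z : ℂ} (hz : 0 < z.im) (n : ℕ) (s : Fin n → ℕ) (ρ : ℝ)
    (h : chainPolynomial n s ρ ≠ 0) : aeval z (chainPolynomial n s ρ) ≠ 0 := by
  induction n generalizing ρ with
  | zero =>
    by_cases h1 : ρ = 0
    · simp [chainPolynomial, h1] at h
    · simp [chainPolynomial, h1]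
  | succ n ih =>
    have hex : ∃ t ∈ fractions (s (Fin.last n)), t ≠ ρ ∧
        chainPolynomial n (Fin.init s) t ≠ 0 := by
      by_contra! hall
      refine h ?_
      simp only [chainPolynomial, descentStep]
      rw [Finset.sum_eq_zero, Finset.sum_eq_zero, mul_zero, add_zero]
      · intro t ht
        exact hall t (Finset.mem_filter.1 ht).1 (Finset.mem_filter.1 ht).2.ne'
      · intro t ht
        exact hall t (Finset.mem_filter.1 ht).1 (Finset.mem_filter.1 ht).2.ne
    obtain ⟨t, ht, hne, h0⟩ := hex
    have h1 := (isArgOrdered_chainPolynomial hz n (Fin.init s)).descentStep_ne_zero hz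
      (fractions (s (Fin.last n))) ht hne (ih _ t h0)
    have := map_descentStep (aeval z : ℝ[X] →ₐ[ℝ] ℂ).toRingHom X (fractions (s (Fin.last n)))
      (chainPolynomial n (Fin.init s)) ρ
    simp only [AlgHom.toRingHom_eq_coe, RingHom.coe_coe, aeval_X] at this
    simpa [chainPolynomial, this] using h1

lemma isRealRooted_of_upperHalfPlane {p : ℝ[X]} (h : ∀ z : ℂ, 0 < z.im → aeval z p ≠ 0) (z : ℂ)
    (hz : aeval z p = 0) : z.im = 0 := by
  rcases lt_trichotomy z.im 0 with h1 | h1 | h1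
  · exfalso
    refine h ((starRingEnd ℂ) z) (by simpa using h1) ?_
    rw [aeval_conj, hz, map_zero]
  · exact h1
  · exact absurd hz (h z h1)

lemma isRealRooted_chainPolynomial (n : ℕ) (s : Fin n → ℕ) (ρ : ℝ) :
    IsRealRooted (chainPolynomial n s ρ) := by
  by_cases h : chainPolynomial n s ρ = 0
  · exact Or.inl h
  · exact Or.inr (isRealRooted_of_upperHalfPlane fun z hz =>
      chainPolynomial_aeval_ne_zero hz n s ρ h)

/-! ### From real-rootedness to `γ`-nonnegativity -/

lemma IsGammaNonnegative.add {d : ℕ} {p q : ℝ[X]} (hp : IsGammaNonnegative d p)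
    (hq : IsGammaNonnegative d q) : IsGammaNonnegative d (p + q) := by
  obtain ⟨γ, h0, rfl⟩ := hp
  obtain ⟨δ, h1, rfl⟩ := hq
  refine ⟨fun i => γ i + δ i, fun i hi => add_nonneg (h0 i hi) (h1 i hi), ?_⟩
  simp only [C_add, add_mul, Finset.sum_add_distrib]

lemma IsGammaNonnegative.C_mul {d : ℕ} {p : ℝ[X]} (hp : IsGammaNonnegative d p) {c : ℝ}
    (hc : 0 ≤ c) : IsGammaNonnegative d (C c * p) := by
  obtain ⟨γ, h0, rfl⟩ := hp
  refine ⟨fun i => c * γ i, fun i hi => mul_nonneg hc (h0 i hi), ?_⟩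
  simp only [Polynomial.C_mul, Finset.mul_sum, mul_assoc]

lemma isGammaNonnegative_zero (d : ℕ) : IsGammaNonnegative d 0 :=
  ⟨fun _ => 0, fun _ _ => le_rfl, by simp⟩

lemma IsGammaNonnegative.X_mul {d : ℕ} {p : ℝ[X]} (hp : IsGammaNonnegative d p) :
    IsGammaNonnegative (d + 2) (X * p) := by
  obtain ⟨γ, h0, rfl⟩ := hp
  refine ⟨fun i => if i = 0 then 0 else γ (i - 1), fun i hi => ?_, ?_⟩
  · dsimp only
    split_ifs
    · exact le_rfl
    · exact h0 _ (by omega)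
  · rw [show (d + 2) / 2 + 1 = (d / 2 + 1) + 1 by omega,
      Finset.sum_range_succ' _ (d / 2 + 1)]
    simp only [Nat.add_eq_zero_iff, one_ne_zero, and_false, if_false, if_true, C_0, zero_mul,
      add_zero, Nat.add_sub_cancel]
    rw [Finset.mul_sum]
    refine Finset.sum_congr rfl fun i _ => ?_
    rw [show d + 2 - 2 * (i + 1) = d - 2 * i by omega, pow_succ]
    ring

lemma IsGammaNonnegative.X_add_one_mul {d : ℕ} {p : ℝ[X]} (hp : IsGammaNonnegative d p) :
    IsGammaNonnegative (d + 1) ((X + 1) * p) := by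
  obtain ⟨γ, h0, rfl⟩ := hp
  -- For odd `d` the range of indices grows by one, and the new coefficient is `0`.
  refine ⟨fun i => if i ≤ d / 2 then γ i else 0, fun i hi => ?_, ?_⟩
  · dsimp only
    split_ifs with h
    · exact h0 _ h
    · exact le_rfl
  · rw [Finset.mul_sum]
    refine Finset.sum_subset_zero_on_sdiff (Finset.range_mono (by omega)) ?_ ?_
    · intro i hi
      simp only [Finset.mem_sdiff, Finset.mem_range] at hi
      dsimp only
      rw [if_neg (by omega)]
      simp
    · intro i hi
      have hi' : i ≤ d / 2 := by simpa [Nat.lt_succ_iff] using hi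
      dsimp only
      rw [if_pos hi', show d + 1 - 2 * i = (d - 2 * i) + 1 by omega, pow_succ (X + 1)]
      ring

/-- Symmetry of a product with respect to `d + e` and of one factor with respect to `e` implies
symmetry of the other factor. -/
lemma reflect_eq_of_mul {d e : ℕ} {q r : ℝ[X]} (hr : r ≠ 0) (hrd : r.natDegree ≤ e)
    (hqd : q.natDegree ≤ d) (hre : reflect e r = r) (h : reflect (e + d) (r * q) = r * q) :
    reflect d q = q := by
  rw [reflect_mul r q hrd hqd, hre] at h
  exact mul_left_cancel₀ hr h

/-- A real-rooted polynomial that is symmetric and positive on the positive axis is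
`γ`-nonnegative. -/
theorem isGammaNonnegative_of_realRooted (d : ℕ) (p : ℝ[X]) (hd : p.natDegree ≤ d)
    (hsym : reflect d p = p) (hroot : ∀ z : ℂ, aeval z p = 0 → z.im = 0)
    (hpos : ∀ x : ℝ, 0 < x → 0 < p.eval x) : IsGammaNonnegative d p := by
  induction d using Nat.strong_induction_on generalizing p with
  | _ d ih =>
  have hp : p ≠ 0 := by
    rintro rfl
    simpa using hpos 1 one_pos
  have hcoeff : ∀ k ≤ d, p.coeff k = p.coeff (d - k) := fun k hk => by
    conv_lhs => rw [← hsym]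
    rw [coeff_reflect, revAt_le hk]
  -- A factor `r`, symmetric with respect to `e` and positive on the positive axis, can be split
  -- off; the induction hypothesis then applies to the quotient.
  have quot : ∀ e q r, p = r * q → r.natDegree ≤ e → r ≠ 0 → reflect e r = r → 0 < e → e ≤ d →
      q.natDegree ≤ d - e → (∀ x : ℝ, 0 < x → 0 < r.eval x) → IsGammaNonnegative (d - e) q := by
    intro e q r hpq hre hr hrr he hed hqd hrpos
    refine ih (d - e) (by omega) q hqd ?_ (fun z hz => hroot z ?_) fun x hx => ?_
    · refine reflect_eq_of_mul hr hre hqd hrr ?_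
      rw [← hpq, Nat.add_sub_cancel' hed, hsym]
    · rw [hpq, map_mul, hz, mul_zero]
    · have := hpos x hx
      rw [hpq, eval_mul] at this
      exact pos_of_mul_pos_right this (hrpos x hx).le
  by_cases h0 : p.coeff 0 = 0
  · obtain ⟨q, hq⟩ := X_dvd_iff.2 h0
    have hq0 : q ≠ 0 := by rintro rfl; simp [hq] at hp
    have hdeg : p.natDegree = q.natDegree + 1 := by rw [hq, natDegree_X_mul hq0]
    -- By symmetry the coefficient of `X ^ d` vanishes too, so splitting off `X` lowers `d` by `2`.
    have hlt : p.natDegree ≠ d := by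
      intro h
      have := hcoeff 0 (Nat.zero_le _)
      rw [h0, Nat.sub_zero, ← h, coeff_natDegree] at this
      exact hp (leadingCoeff_eq_zero.1 this.symm)
    have h2 : 2 ≤ d := by omega
    have hX : reflect 2 (X : ℝ[X]) = X := by
      have := reflect_monomial (R := ℝ) 2 1
      rw [pow_one, revAt_le (by norm_num)] at this
      simpa using this
    have := (quot 2 q X hq (by simp) X_ne_zero hX (by norm_num) h2 (by omega)
      (fun x hx => by simpa using hx)).X_mul
    rwa [Nat.sub_add_cancel h2, ← hq] at this
  have hdeg : p.natDegree = d := by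
    refine le_antisymm hd (le_natDegree_of_ne_zero ?_)
    rwa [hcoeff 0 (Nat.zero_le _), Nat.sub_zero] at h0
  rcases Nat.eq_zero_or_pos d with rfl | hd0
  · rw [eq_C_of_natDegree_eq_zero hdeg]
    have := hpos 1 one_pos
    rw [eq_C_of_natDegree_eq_zero hdeg, eval_C] at this
    exact ⟨fun _ => p.coeff 0, fun _ _ => this.le, by simp⟩
  obtain ⟨w, hw⟩ := IsAlgClosed.exists_aeval_eq_zero ℂ p (by
    rw [degree_eq_natDegree hp, hdeg]; exact_mod_cast hd0.ne')
  obtain ⟨x, rfl⟩ : ∃ x : ℝ, (x : ℂ) = w := ⟨w.re, Complex.ext rfl (by simp [hroot w hw])⟩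
  have hx : p.eval x = 0 := by
    have h1 := aeval_algebraMap_apply_eq_algebraMap_eval (A := ℂ) x p
    rw [Complex.coe_algebraMap, hw] at h1
    exact_mod_cast h1.symm
  have hx0 : x ≠ 0 := by
    rintro rfl
    exact h0 (by rwa [coeff_zero_eq_eval_zero])
  have hxneg : x < 0 := lt_of_le_of_ne (not_lt.1 fun h => (hpos x h).ne' hx) hx0
  by_cases hx1 : x = -1
  · obtain ⟨q, hq⟩ := dvd_iff_isRoot.2 hx
    rw [hx1, C_neg, C_1, sub_neg_eq_add] at hq
    have hne : (X + 1 : ℝ[X]) ≠ 0 := by simpa using X_add_C_ne_zero (1 : ℝ)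
    have hnd : (X + 1 : ℝ[X]).natDegree = 1 := by simpa using natDegree_X_add_C (1 : ℝ)
    have hq0 : q ≠ 0 := by rintro rfl; simp [hq] at hp
    have hdq : p.natDegree = 1 + q.natDegree := by rw [hq, natDegree_mul hne hq0, hnd]
    have hr : reflect 1 (X + 1 : ℝ[X]) = X + 1 := by
      have h1 := reflect_monomial (R := ℝ) 1 1
      have h2 := reflect_monomial (R := ℝ) 1 0
      rw [revAt_le (by norm_num)] at h1 h2
      simp only [pow_one, pow_zero, Nat.sub_self, Nat.sub_zero] at h1 h2
      rw [reflect_add, h1, h2, add_comm]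
    have := (quot 1 q _ hq hnd.le hne hr one_pos hd0 (by omega)
      (fun x hx => by simp; linarith)).X_add_one_mul
    rwa [Nat.sub_add_cancel hd0, ← hq] at this
  have hxi : p.eval x⁻¹ = 0 := by
    let _ := invertibleOfNonzero hx0
    have h1 := (eval₂_reflect_eq_zero_iff (RingHom.id ℝ) x d p hd).2 hx
    rwa [hsym, invOf_eq_inv] at h1
  have hxx : x ≠ x⁻¹ := by
    intro h
    have h1 : x * x = 1 := by nth_rewrite 2 [h]; exact mul_inv_cancel₀ hx0
    have h2 : (x + 1) * (x - 1) = 0 := by linarith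
    rcases mul_eq_zero.1 h2 with h3 | h3
    · exact hx1 (by linarith)
    · linarith
  obtain ⟨q, hq⟩ : (X - C x) * (X - C x⁻¹) ∣ p :=
    (pairwise_coprime_X_sub_C Function.injective_id hxx).mul_dvd
      (dvd_iff_isRoot.2 hx) (dvd_iff_isRoot.2 hxi)
  have hr : (X - C x) * (X - C x⁻¹) = X ^ 2 + C (-x - x⁻¹) * X + C (1 : ℝ) := by
    have : C x * C x⁻¹ = C (1 : ℝ) := by rw [← C_mul, mul_inv_cancel₀ hx0]
    rw [← this, C_sub, C_neg]; ring
  have hne : (X - C x) * (X - C x⁻¹) ≠ 0 := mul_ne_zero (X_sub_C_ne_zero _) (X_sub_C_ne_zero _)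
  have hnd : ((X - C x) * (X - C x⁻¹)).natDegree = 2 := by
    rw [natDegree_mul (X_sub_C_ne_zero _) (X_sub_C_ne_zero _), natDegree_X_sub_C,
      natDegree_X_sub_C]
  have hq0 : q ≠ 0 := by rintro rfl; simp [hq] at hp
  have hdq : p.natDegree = 2 + q.natDegree := by rw [hq, natDegree_mul hne hq0, hnd]
  have hrefl : reflect 2 ((X - C x) * (X - C x⁻¹)) = (X - C x) * (X - C x⁻¹) := by
    rw [hr]
    have h1 := reflect_C_mul_X_pow (R := ℝ) 2 1 (c := -x - x⁻¹)
    have h2 := reflect_monomial (R := ℝ) 2 2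
    have h3 := reflect_C (R := ℝ) 1 2
    rw [revAt_le (by norm_num)] at h1 h2
    simp only [pow_one, pow_zero, Nat.sub_self] at h1 h2
    rw [reflect_add, reflect_add, h1, h2, h3]
    norm_num
    ring
  have hxineg : x⁻¹ < 0 := inv_lt_zero.2 hxneg
  have hg := quot 2 q _ hq hnd.le hne hrefl (by norm_num) (by omega) (by omega) fun y hy => by
    rw [eval_mul]
    refine mul_pos ?_ ?_ <;> simp <;> linarith
  -- This is the coefficient of `X` once `(X - x)(X - x⁻¹)` is written as `(X + 1)² + c X`.
  have hc : 0 ≤ -x - x⁻¹ - 2 := by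
    have h1 : x * x⁻¹ = 1 := mul_inv_cancel₀ hx0
    have h2 : (-x - x⁻¹ - 2) * (-x) = (x + 1) ^ 2 := by linear_combination h1
    exact nonneg_of_mul_nonneg_left (h2 ▸ sq_nonneg _) (by linarith)
  have := hg.X_add_one_mul.X_add_one_mul.add (hg.X_mul.C_mul hc)
  rw [show d - 2 + 2 = d by omega] at this
  convert this using 1
  rw [hq, hr, C_sub (b := (2 : ℝ)), show (C 2 : ℝ[X]) = 2 from rfl, C_1]
  ring

/-! ### Vertices and the open parallelepiped -/

/-- The vertices of the lecture hall simplex. -/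
def vertex {n : ℕ} (s : Fin n → ℕ) (j : Fin (n + 1)) : Fin n → ℝ :=
  fun i => if j ≤ i.castSucc then (s i : ℝ) else 0

lemma vertex_injective {n : ℕ} {s : Fin n → ℕ} (hs : ∀ i, 0 < s i) :
    Function.Injective (vertex s) := by
  have key : ∀ j k : Fin (n + 1), j < k → vertex s j ≠ vertex s k := by
    intro j k hjk h
    have hj : (j : ℕ) < n := by have := k.2; have : (j : ℕ) < k := hjk; omega
    have h1 := congrFun h ⟨j, hj⟩
    have e : Fin.castSucc ⟨(j : ℕ), hj⟩ = j := rfl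
    simp only [vertex, e, le_refl, if_true, if_neg hjk.not_ge] at h1
    exact (hs _).ne' (by exact_mod_cast h1)
  intro j k h
  rcases lt_trichotomy j k with h1 | h1 | h1
  · exact absurd h (key _ _ h1)
  · exact h1
  · exact absurd h.symm (key _ _ h1)

lemma vertex_mem {n : ℕ} {s : Fin n → ℕ} (hs : ∀ i, 0 < s i) (j : Fin (n + 1)) :
    vertex s j ∈ lectureHallSimplex s := by
  have e : ∀ i, vertex s j i / s i = if j ≤ i.castSucc then 1 else 0 := fun i => by
    have : (s i : ℝ) ≠ 0 := by exact_mod_cast (hs i).ne'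
    simp only [vertex]
    split_ifs
    · exact div_self this
    · exact zero_div _
  refine ⟨fun i => ?_, fun i k hik => ?_, fun i => ?_⟩
  · rw [e]; split_ifs <;> norm_num
  · have : i.castSucc ≤ k.castSucc := hik
    simp only [e]
    split_ifs with h1 h2
    · exact le_rfl
    · exact absurd (h1.trans this) h2
    · exact zero_le_one
    · exact le_rfl
  · rw [e]; split_ifs <;> norm_num

/-- The barycentric coordinates of `x` are the successive differences of `0, x₁/s₁, …, xₙ/sₙ, 1`,
the sequence `Y` below; the coordinate sums telescope. -/
lemma lectureHallSimplex_subset_convexHull {n : ℕ} {s : Fin n → ℕ} (hs : ∀ i, 0 < s i) :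
    lectureHallSimplex s ⊆ convexHull ℝ (Set.range (vertex s)) := by
  rintro x ⟨h0, hmono, h1⟩
  let Y : ℕ → ℝ := fun k =>
    if k = 0 then 0 else if h : k - 1 < n then x ⟨k - 1, h⟩ / s ⟨k - 1, h⟩ else 1
  have hYsucc : ∀ i : Fin n, Y (i + 1) = x i / s i := fun i => by simp [Y]
  have hYn : Y (n + 1) = 1 := by simp [Y]
  have hY0 : Y 0 = 0 := by simp [Y]
  have hstep : ∀ j : ℕ, j ≤ n → 0 ≤ Y (j + 1) - Y j := by
    intro j hj
    rcases hj.eq_or_lt with rfl | hj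
    · rw [hYn]
      rcases j with _ | j
      · simp [hY0]
      · have := hYsucc ⟨j, by omega⟩
        simp only at this
        rw [this]; linarith [h1 ⟨j, by omega⟩]
    · have e1 := hYsucc ⟨j, hj⟩
      simp only at e1
      rw [e1]
      rcases j with _ | j
      · rw [hY0, sub_zero]; exact h0 _
      · have e2 := hYsucc ⟨j, by omega⟩
        simp only at e2
        rw [e2, sub_nonneg]
        exact hmono (show (⟨j, by omega⟩ : Fin n) ≤ ⟨j + 1, hj⟩ from Nat.le_succ j)
  refine mem_convexHull_of_exists_fintype (fun j : Fin (n + 1) => Y (j + 1) - Y j) (vertex s)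
    (fun j => hstep j (Nat.lt_succ_iff.1 j.2)) ?_ (fun j => ⟨j, rfl⟩) ?_
  · rw [Fin.sum_univ_eq_sum_range (fun j => Y (j + 1) - Y j), Finset.sum_range_sub, hYn, hY0,
      sub_zero]
  · ext i
    have hsi : (s i : ℝ) ≠ 0 := by exact_mod_cast (hs i).ne'
    rw [Finset.sum_apply]
    have e : ∀ j : Fin (n + 1), ((Y (j + 1) - Y j) • vertex s j) i =
        (fun k : ℕ => if k ∈ Finset.range (i + 1) then (Y (k + 1) - Y k) * s i else 0) j := by
      intro j
      have : (j ≤ i.castSucc) ↔ (j : ℕ) < i + 1 := by rw [Nat.lt_succ_iff]; rfl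
      simp [vertex, this]
    rw [Finset.sum_congr rfl fun j _ => e j, Fin.sum_univ_eq_sum_range (fun k : ℕ =>
      if k ∈ Finset.range (i + 1) then (Y (k + 1) - Y k) * s i else 0), Finset.sum_ite_mem,
      Finset.inter_eq_right.2 (Finset.range_mono (by omega)), ← Finset.sum_mul,
      Finset.sum_range_sub, hYsucc, hY0, sub_zero, div_mul_cancel₀ _ hsi]

/-- Extreme points of a convex hull lie in the generating set. Conversely, each coordinate of a
vertex is an endpoint of the interval `[0, s i]`, which contains that coordinate of every point of
the simplex. -/
lemma extremePoints_lectureHallSimplex {n : ℕ} {s : Fin n → ℕ} (hs : ∀ i, 0 < s i) :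
    (lectureHallSimplex s).extremePoints ℝ = Set.range (vertex s) := by
  apply Set.Subset.antisymm
  · intro x hx
    have hconv : convexHull ℝ (Set.range (vertex s)) = lectureHallSimplex s := by
      refine Set.Subset.antisymm (convexHull_min ?_ ?_) (lectureHallSimplex_subset_convexHull hs)
      · rintro _ ⟨j, rfl⟩
        exact vertex_mem hs j
      · intro x hx y hy a b ha hb hab
        have e : ∀ i, (a • x + b • y) i / s i = a * (x i / s i) + b * (y i / s i) := fun i => by
          simp only [Pi.add_apply, Pi.smul_apply, smul_eq_mul]; ring
        refine ⟨fun i => ?_, fun i k hik => ?_, fun i => ?_⟩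
        · rw [e]
          exact add_nonneg (mul_nonneg ha (hx.1 i)) (mul_nonneg hb (hy.1 i))
        · simp only [e]
          exact add_le_add (mul_le_mul_of_nonneg_left (hx.2.1 hik) ha)
            (mul_le_mul_of_nonneg_left (hy.2.1 hik) hb)
        · rw [e]
          nlinarith [hx.2.2 i, hy.2.2 i]
    rw [← hconv] at hx
    exact extremePoints_convexHull_subset hx
  · rintro _ ⟨j, rfl⟩
    refine mem_extremePoints_iff_left.2 ⟨vertex_mem hs j, fun x hx y hy hxy => ?_⟩
    obtain ⟨a, b, ha, hb, hab, h⟩ := hxy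
    ext i
    have hsi : (0 : ℝ) < s i := by exact_mod_cast hs i
    have hi := congrFun h i
    have hx0 : 0 ≤ x i := by simpa using (le_div_iff₀ hsi).1 (hx.1 i)
    have hy0 : 0 ≤ y i := by simpa using (le_div_iff₀ hsi).1 (hy.1 i)
    have hx1 := (div_le_one hsi).1 (hx.2.2 i)
    have hy1 := (div_le_one hsi).1 (hy.2.2 i)
    simp only [Pi.add_apply, Pi.smul_apply, smul_eq_mul, vertex] at hi ⊢
    obtain rfl : b = 1 - a := by linarith
    split_ifs at hi ⊢
    · nlinarith
    · nlinarith

lemma mem_openParallelepiped {n : ℕ} {s : Fin n → ℕ} (hs : ∀ i, 0 < s i) (y : Fin (n + 1) → ℝ) :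
    y ∈ openParallelepiped (lectureHallSimplex s) ↔
      ∃ l : Fin (n + 1) → ℝ, (∀ j, 0 < l j ∧ l j < 1) ∧
        (∀ i : Fin n, y i.castSucc = s i * ∑ j, if j ≤ i.castSucc then l j else 0) ∧
        y (Fin.last n) = ∑ j, l j := by
  have hinj := vertex_injective hs
  have expand : ∀ l : Fin (n + 1) → ℝ, y = ∑ j, l j • atHeightOne (vertex s j) ↔
      (∀ i : Fin n, y i.castSucc = s i * ∑ j, if j ≤ i.castSucc then l j else 0) ∧
        y (Fin.last n) = ∑ j, l j := by
    intro l
    rw [funext_iff, Fin.forall_fin_succ']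
    refine and_congr (forall_congr' fun i => ?_) ?_
    · simp only [Finset.sum_apply, Pi.smul_apply, smul_eq_mul, atHeightOne, Fin.snoc_castSucc,
        vertex, Finset.mul_sum, mul_ite, mul_zero, mul_comm]
    · simp only [Finset.sum_apply, Pi.smul_apply, smul_eq_mul, atHeightOne, Fin.snoc_last, mul_one]
  simp only [openParallelepiped, extremePoints_lectureHallSimplex hs, Set.mem_ofPred_eq,
    finsum_mem_range hinj, finsum_eq_sum_of_fintype, Set.forall_mem_range]
  constructor
  · rintro ⟨c, hc, h⟩
    exact ⟨fun j => c (vertex s j), hc, (expand _).1 h⟩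
  · rintro ⟨l, hl, h⟩
    refine ⟨Function.extend (vertex s) l 0, fun j => ?_, ?_⟩
    · rw [hinj.extend_apply]; exact hl j
    · simp only [hinj.extend_apply]
      exact (expand l).2 h

/-! ### Chains and lattice points -/

/-- The integer sequences `x` for which the successive differences of
`0, x₁/s₁, …, xₙ/sₙ, y` lie strictly between `0` and `1`. -/
def chains : (n : ℕ) → (Fin n → ℕ) → ℝ → Finset (Fin n → ℤ)
  | 0, _, y => if 0 < y ∧ y < 1 then Finset.univ else ∅
  | n + 1, s, y =>
    -- These are the integers `k` with `y - 1 < k / s < y`, where `s` is the last entry.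
    (Finset.Ioo ⌊(s (Fin.last n) : ℝ) * (y - 1)⌋ ⌈(s (Fin.last n) : ℝ) * y⌉).biUnion fun k =>
      (chains n (Fin.init s) (k / s (Fin.last n))).image fun x => Fin.snoc (α := fun _ => ℤ) x k

lemma mem_chains_succ {n : ℕ} {s : Fin (n + 1) → ℕ} (hs : ∀ i, 0 < s i) (y : ℝ)
    (x : Fin (n + 1) → ℤ) : x ∈ chains (n + 1) s y ↔
      Fin.init x ∈ chains n (Fin.init s) (x (Fin.last n) / s (Fin.last n)) ∧
        0 < y - x (Fin.last n) / s (Fin.last n) ∧ y - x (Fin.last n) / s (Fin.last n) < 1 := by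
  have hpos : (0 : ℝ) < s (Fin.last n) := by exact_mod_cast hs _
  have hIoo : ∀ k : ℤ, k ∈ Finset.Ioo ⌊(s (Fin.last n) : ℝ) * (y - 1)⌋ ⌈(s (Fin.last n) : ℝ) * y⌉ ↔
      0 < y - k / s (Fin.last n) ∧ y - k / s (Fin.last n) < 1 := by
    intro k
    rw [Finset.mem_Ioo, Int.floor_lt, Int.lt_ceil, and_comm, sub_pos, div_lt_iff₀ hpos, mul_comm,
      sub_lt_comm, lt_div_iff₀ hpos, mul_comm (y - 1)]
  simp only [chains, Finset.mem_biUnion, hIoo, Finset.mem_image]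
  constructor
  · rintro ⟨k, hk, w, hw, rfl⟩
    rw [Fin.init_snoc, Fin.snoc_last]
    exact ⟨hw, hk⟩
  · rintro ⟨h1, h2⟩
    exact ⟨_, h2, _, h1, Fin.snoc_init_self x⟩

lemma card_chains_succ {n : ℕ} (s : Fin (n + 1) → ℕ) (y : ℝ) :
    (chains (n + 1) s y).card =
      ∑ k ∈ Finset.Ioo ⌊(s (Fin.last n) : ℝ) * (y - 1)⌋ ⌈(s (Fin.last n) : ℝ) * y⌉,
        (chains n (Fin.init s) (k / s (Fin.last n))).card := by
  rw [chains, Finset.card_biUnion]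
  · refine Finset.sum_congr rfl fun k _ => Finset.card_image_of_injective _ fun x x' h => ?_
    have := congrArg (Fin.init (α := fun _ => ℤ)) h
    simpa using this
  · intro k _ k' _ hkk
    rw [Function.onFun, Finset.disjoint_left]
    rintro _ h h'
    obtain ⟨w, _, rfl⟩ := Finset.mem_image.1 h
    obtain ⟨w', _, h2⟩ := Finset.mem_image.1 h'
    have := congrFun h2 (Fin.last n)
    simp only [Fin.snoc_last] at this
    exact hkk this.symm

lemma mem_chains {n : ℕ} {s : Fin n → ℕ} (hs : ∀ i, 0 < s i) (y : ℝ) (x : Fin n → ℤ) :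
    x ∈ chains n s y ↔ ∃ l : Fin (n + 1) → ℝ, (∀ j, 0 < l j ∧ l j < 1) ∧
        (∀ i : Fin n, (x i : ℝ) = s i * ∑ j, if j ≤ i.castSucc then l j else 0) ∧
        y = ∑ j, l j := by
  induction n generalizing y with
  | zero =>
    constructor
    · intro h
      have h' : 0 < y ∧ y < 1 := by
        by_contra hc
        simp [chains, hc] at h
      exact ⟨fun _ => y, fun _ => h', fun i => i.elim0, by simp⟩
    · rintro ⟨l, hl, -, rfl⟩
      have := hl 0
      simpa [chains, this] using Subsingleton.elim _ _
  | succ n ih =>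
    have hpos : (0 : ℝ) < s (Fin.last n) := by exact_mod_cast hs _
    rw [mem_chains_succ hs, ih (s := Fin.init s) fun i => hs _]
    have hlast : ∀ i : Fin (n + 1), ¬ Fin.last (n + 1) ≤ i.castSucc := fun i =>
      (Fin.castSucc_lt_last i).not_ge
    constructor
    · rintro ⟨⟨l, hl, hx, hy⟩, h1, h2⟩
      -- The new last coefficient is the last difference of the chain.
      refine ⟨Fin.snoc (α := fun _ => ℝ) l (y - x (Fin.last n) / s (Fin.last n)), ?_, ?_, ?_⟩
      · refine Fin.lastCases ?_ fun j => ?_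
        · rw [Fin.snoc_last]; exact ⟨h1, h2⟩
        · simpa using hl j
      · refine Fin.lastCases ?_ fun i => ?_
        · rw [Fin.sum_univ_castSucc]
          simp only [hlast, if_false, Fin.snoc_castSucc, Fin.castSucc_le_castSucc_iff, Fin.le_last,
            if_true, add_zero, ← hy]
          field_simp
        · rw [Fin.sum_univ_castSucc]
          simpa only [hlast, if_false, Fin.snoc_castSucc, Fin.castSucc_le_castSucc_iff, add_zero]
            using! hx i
      · rw [Fin.sum_univ_castSucc]
        simp only [Fin.snoc_castSucc, Fin.snoc_last, ← hy]
        ring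
    · rintro ⟨l, hl, hx, rfl⟩
      have hx' := hx (Fin.last n)
      rw [Fin.sum_univ_castSucc] at hx'
      simp only [hlast, if_false, Fin.castSucc_le_castSucc_iff, Fin.le_last, if_true,
        add_zero] at hx'
      have hdiv : (x (Fin.last n) : ℝ) / s (Fin.last n) = ∑ j : Fin (n + 1), l j.castSucc := by
        rw [hx']; field_simp
      refine ⟨⟨fun j => l j.castSucc, fun j => hl _, fun i => ?_, hdiv⟩, ?_⟩
      · have := hx i.castSucc
        rw [Fin.sum_univ_castSucc] at this
        simpa only [hlast, if_false, Fin.castSucc_le_castSucc_iff, add_zero] using! this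
      · rw [hdiv, Fin.sum_univ_castSucc, add_sub_cancel_left]
        exact hl _

lemma mem_boxPoints {n : ℕ} {s : Fin n → ℕ} (hs : ∀ i, 0 < s i) (x : Fin (n + 1) → ℤ) :
    x ∈ boxPoints (lectureHallSimplex s) ↔ Fin.init x ∈ chains n s (x (Fin.last n)) := by
  rw [mem_chains hs]
  exact mem_openParallelepiped hs _

lemma height_of_mem_chains {n : ℕ} {s : Fin n → ℕ} (hs : ∀ i, 0 < s i) {y : ℝ} {x : Fin n → ℤ}
    (h : x ∈ chains n s y) : 0 < y ∧ y < n + 1 := by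
  obtain ⟨l, hl, -, rfl⟩ := (mem_chains hs y x).1 h
  constructor
  · exact Finset.sum_pos (fun j _ => (hl j).1) Finset.univ_nonempty
  · calc ∑ j, l j < ∑ j : Fin (n + 1), (1 : ℝ) :=
        Finset.sum_lt_sum_of_nonempty Finset.univ_nonempty fun j _ => (hl j).2
      _ = n + 1 := by simp

/-- The involution `λ ↦ 1 - λ` of the parallelepiped, read on chains, is `r`. -/
lemma card_chains_symm {n : ℕ} {s : Fin n → ℕ} (hs : ∀ i, 0 < s i) (y : ℝ) :
    (chains n s y).card = (chains n s (n + 1 - y)).card := by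
  let r : (Fin n → ℤ) → Fin n → ℤ := fun x i =>
    s i * (∑ j : Fin (n + 1), if j ≤ i.castSucc then 1 else 0) - x i
  have hr : ∀ y x, x ∈ chains n s y → r x ∈ chains n s (n + 1 - y) := by
    intro y x hx
    obtain ⟨l, hl, hxl, rfl⟩ := (mem_chains hs y x).1 hx
    refine (mem_chains hs _ _).2 ⟨fun j => 1 - l j, fun j => ?_, fun i => ?_, ?_⟩
    · constructor <;> linarith [(hl j).1, (hl j).2]
    · simp only [r]
      push_cast
      rw [hxl i, ← mul_sub, ← Finset.sum_sub_distrib]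
      congr 1
      refine Finset.sum_congr rfl fun j _ => ?_
      split_ifs <;> simp
    · simp
  refine Finset.card_nbij' r r (hr y) (fun x hx => ?_) (fun x _ => ?_) fun x _ => ?_
  · have := hr _ x hx
    rwa [sub_sub_cancel] at this
  · funext i; simp [r]
  · funext i; simp [r]

lemma coeff_sDerangementPolynomial {n : ℕ} {s : Fin n → ℕ} (hs : ∀ i, 0 < s i) (h : ℕ) :
    (sDerangementPolynomial s).coeff h = (chains n s h).card := by
  -- Heights lie strictly between `0` and `n + 1`, so these finitely many layers contain every box
  -- point.
  let B : Finset (Fin (n + 1) → ℤ) := (Finset.range (n + 1)).biUnion fun h =>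
    (chains n s h).image fun x => Fin.snoc (α := fun _ => ℤ) x (h : ℤ)
  have hB : boxPoints (lectureHallSimplex s) = B := by
    ext x
    rw [mem_boxPoints hs]
    simp only [B, Finset.mem_coe, Finset.mem_biUnion, Finset.mem_image, Finset.mem_range]
    constructor
    · intro hx
      have h1 := height_of_mem_chains hs hx
      have h2 : 0 < x (Fin.last n) := by exact_mod_cast h1.1
      have h3 : x (Fin.last n) < n + 1 := by exact_mod_cast h1.2
      refine ⟨(x (Fin.last n)).toNat, by omega, Fin.init x, ?_, ?_⟩
      · have : (((x (Fin.last n)).toNat : ℕ) : ℝ) = ((x (Fin.last n) : ℤ) : ℝ) := by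
          rw [← Int.cast_natCast, Int.toNat_of_nonneg h2.le]
        rwa [this]
      · rw [Int.toNat_of_nonneg h2.le]; exact Fin.snoc_init_self x
    · rintro ⟨h, -, w, hw, rfl⟩
      simpa using hw
  have hcoeff : (sDerangementPolynomial s).coeff h =
      ∑ x ∈ B, if h = (x (Fin.last n)).toNat then (1 : ℝ) else 0 := by
    rw [sDerangementPolynomial, boxPolynomial, hB, finsum_mem_coe_finset, finsetSum_coeff]
    simp only [coeff_X_pow]
  rw [hcoeff, Finset.sum_boole]
  congr 1
  symm
  refine Finset.card_nbij' (fun x => Fin.snoc (α := fun _ => ℤ) x (h : ℤ)) Fin.init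
    (fun x hx => ?_) (fun x hx => ?_) (fun x _ => by simp) fun x hx => ?_
  · have := (height_of_mem_chains hs hx).2
    simp only [Finset.coe_filter, Set.mem_ofPred_eq, Fin.snoc_last, Int.toNat_natCast, and_true, B,
      Finset.mem_biUnion, Finset.mem_image, Finset.mem_range]
    exact ⟨h, by exact_mod_cast this, x, hx, rfl⟩
  all_goals
    simp only [Finset.coe_filter, Set.mem_ofPred_eq] at hx
    have h1 : x ∈ boxPoints (lectureHallSimplex s) := by rw [hB]; exact hx.1
    rw [mem_boxPoints hs] at h1
    have h2 : 0 < x (Fin.last n) := by exact_mod_cast (height_of_mem_chains hs h1).1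
    have h3 : x (Fin.last n) = h := by omega
  · rw [h3] at h1
    exact_mod_cast h1
  · rw [← h3]; exact Fin.snoc_init_self x

/-- The last entry is `a = e + k q` with remainder `e` and floor `q` of `a / k`. Strict differences
force `q = m` with `e / k < ρ`, or `q = m - 1` with `e / k > ρ`: the two sums of `descentStep`. -/
lemma coeff_chainPolynomial {n : ℕ} {s : Fin n → ℕ} (hs : ∀ i, 0 < s i) {ρ : ℝ} (h0 : 0 ≤ ρ)
    (h1 : ρ < 1) (m : ℕ) :
    (chainPolynomial n s ρ).coeff m = (chains n s (ρ + m)).card := by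
  induction n generalizing ρ m with
  | zero =>
    rcases m with _ | m
    · by_cases hρ : ρ = 0
      · simp [chainPolynomial, chains, hρ]
      · have : 0 < ρ := lt_of_le_of_ne h0 (Ne.symm hρ)
        simp [chainPolynomial, chains, hρ, this, h1]
    · have h2 : ¬ (ρ + (m + 1 : ℕ) < 1) := by
        push_cast; have : (0 : ℝ) ≤ m := m.cast_nonneg; linarith
      by_cases hρ : ρ = 0
      · rw [hρ] at h2
        simp only [chainPolynomial, hρ, if_true, chains, h2, and_false, if_false,
          Finset.card_empty]
        simp
      · simp only [chainPolynomial, hρ, if_false, chains, h2, and_false, Finset.card_empty]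
        simp [coeff_one]
  | succ n ih =>
    have ih' := fun {ρ : ℝ} => ih (s := Fin.init s) (fun i => hs _) (ρ := ρ)
    have hk0 := hs (Fin.last n)
    rw [card_chains_succ]
    simp only [chainPolynomial]
    generalize s (Fin.last n) = k at *
    have hk : (0 : ℝ) < k := by exact_mod_cast hk0
    have hinj : Function.Injective fun e : ℕ => (e : ℝ) / k := fun a b h => by
      have := (div_left_inj' hk.ne').1 h
      exact_mod_cast this
    have hfrac : ∀ e ∈ Finset.range k, 0 ≤ (e : ℝ) / k ∧ (e : ℝ) / k < 1 := fun e he => by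
      refine ⟨by positivity, (div_lt_one hk).2 ?_⟩
      exact_mod_cast Finset.mem_range.1 he
    let g : ℤ → ℝ := fun a => ((chains n (Fin.init s) (a / k)).card : ℝ)
    have hg : ∀ e ∈ Finset.range k, ∀ m : ℕ,
        (chainPolynomial n (Fin.init s) (e / k)).coeff m = g (e + k * m) := by
      intro e he m
      rw [ih' (hfrac e he).1 (hfrac e he).2]
      simp only [g]
      congr 3
      push_cast
      field_simp
    -- For `m = 0` the second sum involves floor `-1`, but no chain ends at a negative value, in
    -- accordance with the vanishing constant term of a multiple of `X`.
    have hg0 : ∀ e ∈ Finset.range k, g (e + k * (-1)) = 0 := by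
      intro e he
      simp only [g, Nat.cast_eq_zero, Finset.card_eq_zero]
      refine Finset.eq_empty_of_forall_notMem fun x hx => ?_
      have h2 := (height_of_mem_chains (s := Fin.init s) (fun i => hs _) hx).1
      have h3 := (hfrac e he).2
      push_cast at h2
      rw [add_div, mul_div_cancel_left₀ _ hk.ne'] at h2
      linarith
    have low : (∑ t ∈ fractions k with t < ρ, chainPolynomial n (Fin.init s) t).coeff m =
        ∑ e ∈ (Finset.range k).filter fun e : ℕ => (e : ℝ) / k < ρ, g (e + k * m) := by
      rw [finsetSum_coeff, fractions, Finset.filter_image, Finset.sum_image hinj.injOn]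
      exact Finset.sum_congr rfl fun e he => hg e (Finset.mem_filter.1 he).1 m
    have high : (X * ∑ t ∈ fractions k with ρ < t, chainPolynomial n (Fin.init s) t).coeff m =
        ∑ e ∈ (Finset.range k).filter fun e : ℕ => ρ < (e : ℝ) / k, g (e + k * (m - 1)) := by
      rw [fractions, Finset.filter_image, Finset.sum_image hinj.injOn]
      rcases m with _ | m
      · rw [coeff_X_mul_zero]
        refine (Finset.sum_eq_zero fun e he => ?_).symm
        simpa using hg0 e (Finset.mem_filter.1 he).1
      · rw [coeff_X_mul, finsetSum_coeff]
        refine Finset.sum_congr rfl fun e he => ?_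
        rw [hg e (Finset.mem_filter.1 he).1 m]
        push_cast
        rw [add_sub_cancel_right]
    rw [descentStep, coeff_add, low, high, Nat.cast_sum]
    change _ = ∑ a ∈ _, g a
    -- The condition `k m ≤ a` separates floor `m` from floor `m - 1`.
    rw [← Finset.sum_filter_add_sum_filter_not _ fun a : ℤ => (k : ℤ) * m ≤ a]
    have hIoo : ∀ a : ℤ, a ∈ Finset.Ioo ⌊(k : ℝ) * (ρ + m - 1)⌋ ⌈(k : ℝ) * (ρ + m)⌉ ↔
        k * (ρ + m - 1) < a ∧ a < k * (ρ + m) := fun a => by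
      rw [Finset.mem_Ioo, Int.floor_lt, Int.lt_ceil]
    have hkρ : k * ρ < k := by nlinarith
    have hkρ0 : 0 ≤ k * ρ := by positivity
    congr 1
    · refine Finset.sum_nbij' (fun e : ℕ => (e + k * m : ℤ)) (fun a => (a - k * m).toNat)
        ?_ ?_ ?_ ?_ fun _ _ => rfl
      · intro e he
        rw [Finset.mem_filter, div_lt_iff₀ hk] at he
        rw [Finset.mem_filter, hIoo]
        push_cast
        refine ⟨⟨?_, ?_⟩, by omega⟩
        · have : (0 : ℝ) ≤ e := e.cast_nonneg
          nlinarith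
        · nlinarith
      · intro a ha
        rw [Finset.mem_filter, hIoo] at ha
        obtain ⟨⟨ha1, ha2⟩, ha3⟩ := ha
        obtain ⟨e, he⟩ := Int.eq_ofNat_of_zero_le (sub_nonneg.2 ha3)
        obtain rfl : a = e + k * m := by linarith
        push_cast at ha2
        have : (e : ℝ) < k * ρ := by nlinarith
        rw [he, Finset.mem_filter, Finset.mem_range, div_lt_iff₀ hk]
        simp only [Int.toNat_natCast]
        refine ⟨?_, by linarith⟩
        exact_mod_cast this.trans hkρ
      · intro e _; simp
      · intro a ha
        have := (Finset.mem_filter.1 ha).2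
        rw [Int.toNat_of_nonneg (by linarith)]; ring
    · refine Finset.sum_nbij' (fun e : ℕ => (e + k * (m - 1) : ℤ))
        (fun a => (a - k * (m - 1)).toNat) ?_ ?_ ?_ ?_ fun _ _ => rfl
      · intro e he
        rw [Finset.mem_filter, lt_div_iff₀ hk, Finset.mem_range] at he
        have he' : (e : ℝ) < k := by exact_mod_cast he.1
        have he'' : (e : ℤ) < k := by exact_mod_cast he.1
        rw [Finset.mem_filter, hIoo]
        push_cast
        refine ⟨⟨?_, ?_⟩, ?_⟩
        · nlinarith
        · nlinarith
        · rw [not_le]; linarith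
      · intro a ha
        rw [Finset.mem_filter, hIoo] at ha
        obtain ⟨⟨ha1, ha2⟩, ha3⟩ := ha
        have hc : (0 : ℝ) < ((a - k * (m - 1) : ℤ) : ℝ) := by push_cast; nlinarith
        obtain ⟨e, he⟩ := Int.eq_ofNat_of_zero_le (by exact_mod_cast hc.le : 0 ≤ a - k * (m - 1))
        obtain rfl : a = e + k * (m - 1) := by linarith
        push_cast at ha1
        rw [he, Finset.mem_filter, Finset.mem_range, lt_div_iff₀ hk]
        simp only [Int.toNat_natCast]
        refine ⟨?_, by linarith⟩
        have : (e : ℤ) < k := by linarith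
        exact_mod_cast this
      · intro e _; simp
      · intro a ha
        rw [Finset.mem_filter, hIoo] at ha
        have hc : (0 : ℝ) < ((a - k * (m - 1) : ℤ) : ℝ) := by push_cast; nlinarith [ha.1.1]
        have hc' : 0 < a - k * (m - 1) := by exact_mod_cast hc
        rw [Int.toNat_of_nonneg hc'.le]; ring

lemma sDerangementPolynomial_eq_chainPolynomial {n : ℕ} {s : Fin n → ℕ} (hs : ∀ i, 0 < s i) :
    sDerangementPolynomial s = chainPolynomial n s 0 := by
  ext m
  rw [coeff_sDerangementPolynomial hs, coeff_chainPolynomial hs le_rfl one_pos, zero_add]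

lemma isSymmetric_sDerangementPolynomial {n : ℕ} {s : Fin n → ℕ} (hs : ∀ i, 0 < s i) :
    IsSymmetric (n + 1) (sDerangementPolynomial s) := by
  refine ⟨natDegree_le_iff_coeff_eq_zero.2 fun h hh => ?_, fun k hk => ?_⟩
  · rw [coeff_sDerangementPolynomial hs, Nat.cast_eq_zero, Finset.card_eq_zero]
    refine Finset.eq_empty_of_forall_notMem fun x hx => ?_
    have h1 := (height_of_mem_chains hs hx).2
    have h2 : h < n + 1 := by exact_mod_cast h1
    omega
  · rw [coeff_sDerangementPolynomial hs, coeff_sDerangementPolynomial hs, card_chains_symm hs,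
      Nat.cast_sub hk]
    push_cast
    rfl

lemma IsSymmetric.reflect_eq {d : ℕ} {p : ℝ[X]} (hp : IsSymmetric d p) : reflect d p = p := by
  ext k
  rw [coeff_reflect]
  rcases le_or_gt k d with h | h
  · rw [revAt_le h, ← hp.2 k h]
  · rw [revAt_eq_self_of_lt h]

lemma eval_pos_of_coeff_nonneg {p : ℝ[X]} (hp : p ≠ 0) (h : ∀ k, 0 ≤ p.coeff k) {x : ℝ}
    (hx : 0 < x) : 0 < p.eval x := by
  rw [eval_eq_sum]
  refine Finset.sum_pos (fun k hk => mul_pos ?_ (pow_pos hx k)) (nonempty_support_iff.2 hp)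
  exact lt_of_le_of_ne (h k) (Ne.symm (mem_support_iff.1 hk))

end LectureHall

end

theorem mainTheorem12 (n : ℕ) (s : Fin n → ℕ) (hs : ∀ i, 0 < s i) :
    LectureHall.IsSymmetric (n + 1) (LectureHall.sDerangementPolynomial s) ∧
    LectureHall.IsRealRooted (LectureHall.sDerangementPolynomial s) ∧
    LectureHall.IsGammaNonnegative (n + 1) (LectureHall.sDerangementPolynomial s) := by
  have hsym := LectureHall.isSymmetric_sDerangementPolynomial hs
  have hreal : LectureHall.IsRealRooted (LectureHall.sDerangementPolynomial s) := by
    rw [LectureHall.sDerangementPolynomial_eq_chainPolynomial hs]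
    exact LectureHall.isRealRooted_chainPolynomial n s 0
  refine ⟨hsym, hreal, ?_⟩
  -- The polynomial can vanish, for instance if the first entry of `s` is `1`; it is then not
  -- positive on the positive axis.
  by_cases h0 : LectureHall.sDerangementPolynomial s = 0
  · rw [h0]
    exact LectureHall.isGammaNonnegative_zero _
  · refine LectureHall.isGammaNonnegative_of_realRooted _ _ hsym.1 hsym.reflect_eq
      (hreal.resolve_left h0) fun x hx => LectureHall.eval_pos_of_coeff_nonneg h0 (fun k => ?_) hx
    rw [LectureHall.coeff_sDerangementPolynomial hs]
    exact Nat.cast_nonneg _
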